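/- All graphs are finite and simple. A graph is *nice* if none of its connected components is isomorphic to $K_2$. For a graph $G$ and a positive integer $k$, a map $\omega\colon E(G)\to\{1,\dots,k\}$ is *neighbour sum distinguishing* if $\sum_{x\in N_G(u)}\omega(ux)\neq\sum_{x\in N_G(v)}\omega(vx)$ for every edge $uv$ of $G$; it is *$d$-relaxed* if every monochromatic set of edges induces a subgraph of maximum degree at most $d$. Let $\chi'^{d}_{\sum}(G)$ be the smallest positive integer $k$ for which there is a neighbour sum distinguishing $d$-relaxed map $\omega\colon E(G)\to\{1,\dots,k\}$. Then every nice graph $G$ with maximum degree $\Delta$ satisfies $$\chi'^{\Delta-1}_{\sum}(G)\le 7,$$ where $\Delta-1$ is read as $0$ if $G$ has no edges. Equivalently, if $G$ has an edge, then $G$ has a neighbour sum distinguishing map $\omega\colon E(G)\to\{1,\dots,7\}$ for which every vertex of degree $\Delta$ is incident with two edges of different weights. -/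

import Mathlib

namespace NeighbourSum

/-- A graph is nice if none of its connected components is isomorphic to `K₂`. -/
def IsNice {V : Type*} (G : SimpleGraph V) : Prop :=
  ∀ c : G.ConnectedComponent, IsEmpty (c.toSimpleGraph ≃g (⊤ : SimpleGraph (Fin 2)))

/-- A `k`-edge-weighting: a map from the edges of `G` to `{1, …, k}`. -/
def IsEdgeWeighting {V : Type*} (G : SimpleGraph V) (k : ℕ) (ω : G.edgeSet → ℕ) : Prop :=
  ∀ e, ω e ∈ Set.Icc 1 k

open Classical in
/-- The induced vertex-colouring: the sum of `ω (vu)` over the neighbours `u` of `v`. -/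
noncomputable def vertexSum {V : Type*} [Fintype V] (G : SimpleGraph V) (ω : G.edgeSet → ℕ)
    (v : V) : ℕ :=
  ∑ u : G.neighborSet v, ω ⟨s(v, u.1), u.2⟩

/-- `ω` is neighbour sum distinguishing: adjacent vertices get different sums. -/
def IsDistinguishing {V : Type*} [Fintype V] (G : SimpleGraph V) (ω : G.edgeSet → ℕ) : Prop :=
  ∀ u v : V, G.Adj u v → vertexSum G ω u ≠ vertexSum G ω v

open Classical in
/-- `ω` is `d`-relaxed: every monochromatic set `F` of edges induces a subgraph of maximum degree
at most `d`. (The subgraph is taken on all of `V`; extra isolated vertices do not change the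
maximum degree.) -/
def IsRelaxed {V : Type*} [Fintype V] (G : SimpleGraph V) (d : ℕ) (ω : G.edgeSet → ℕ) : Prop :=
  ∀ F : Set G.edgeSet, (∀ e ∈ F, ∀ f ∈ F, ω e = ω f) →
    (SimpleGraph.fromEdgeSet (Subtype.val '' F : Set (Sym2 V))).maxDegree ≤ d

/-- The smallest `k ≥ 1` for which `G` admits a neighbour sum distinguishing `d`-relaxed
`k`-edge-colouring (`⊤` if there is none). -/
noncomputable def relaxedIndex {V : Type*} [Fintype V] (G : SimpleGraph V) (d : ℕ) : ℕ∞ :=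
  sInf {m : ℕ∞ | ∃ k : ℕ, m = k ∧ 1 ≤ k ∧ ∃ ω : G.edgeSet → ℕ,
    IsEdgeWeighting G k ω ∧ IsDistinguishing G ω ∧ IsRelaxed G d ω}

end NeighbourSum

/-! When Δ ≥ 3, treat each component separately: fix a root of degree at least 2, which niceness
provides in any component with an edge, and process the other vertices by decreasing distance from
it, so that each one still has an unprocessed neighbour.

A processed vertex `x` reserves two sums `c x`, `c x + 2` with `c x` congruent to 0 or 1 modulo 4.
Distinct values of `c` give disjoint pairs, so it suffices that adjacent vertices have distinct `c`.
When `v` is processed, each edge to an earlier neighbour `x` may take either of two weights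
differing by 2, one for each reserved sum of `x`. These switches and the weights chosen towards
unprocessed vertices give `v` more admissible sums than it has earlier neighbours
(`exists_extension`, `State.step`).

Vertices of degree at least 3 must also see two weights. Later changes are even, so a parity
difference persists, and so does a difference between two edges to processed vertices until the root
is reached. The root has only switches left (`State.finish`); a root of degree 3 may remain
monochromatic, which matters only for Δ = 3 and is cured by changing one edge (`exists_repair`).

When Δ ≤ 2, a greedy colouring of the edges suffices. -/

namespace NeighbourSum

/-! ### Arithmetic of the choices available at one vertex. -/

/-- The residues modulo `4` of the smaller of the two sums reserved for a vertex. -/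
def IsLow (s : ℤ) : Prop := s % 4 = 0 ∨ s % 4 = 1

/-- Increase `l` by `2` on `J`. -/
def raise {V : Type*} [DecidableEq V] (l : V → ℤ) (J : Finset V) (x : V) : ℤ :=
  l x + if x ∈ J then 2 else 0

lemma raise_of_mem {V : Type*} [DecidableEq V] (l : V → ℤ) {J : Finset V} {x : V} (h : x ∈ J) :
    raise l J x = l x + 2 := by simp [raise, h]

lemma raise_of_notMem {V : Type*} [DecidableEq V] (l : V → ℤ) {J : Finset V} {x : V}
    (h : x ∉ J) : raise l J x = l x := by simp [raise, h]

lemma raise_eq_or {V : Type*} [DecidableEq V] (l : V → ℤ) (J : Finset V) (x : V) :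
    raise l J x = l x ∨ raise l J x = l x + 2 := by
  by_cases h : x ∈ J <;> simp [raise, h]

lemma sum_raise {V : Type*} [DecidableEq V] (l : V → ℤ) {B J : Finset V} (h : J ⊆ B) :
    ∑ x ∈ B, raise l J x = ∑ x ∈ B, l x + 2 * (J.card : ℤ) := by
  simp only [raise, Finset.sum_add_distrib, Finset.sum_ite_mem, Finset.inter_eq_right.2 h,
    Finset.sum_const, nsmul_eq_mul]
  ring

/-- The map `k ↦ 2 * k - k % 2` enumerates the integers congruent to 0 or 1 modulo 4 in increasing
order; the rest is pigeonhole. -/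
lemma exists_low_avoiding {V : Type*} (K : Finset ℤ) (B : Finset V) (c : V → ℤ)
    (h : B.card < K.card) : ∃ k ∈ K, ∀ x ∈ B, c x ≠ 2 * k - k % 2 := by
  classical
  have hinj : Function.Injective (fun k : ℤ => 2 * k - k % 2) := by
    intro a b hab
    simp only at hab
    omega
  have h1 : (B.image c).card < (K.image fun k : ℤ => 2 * k - k % 2).card := by
    rw [Finset.card_image_of_injective _ hinj]
    exact Finset.card_image_le.trans_lt h
  obtain ⟨s, hs, hs'⟩ := Finset.exists_mem_notMem_of_card_lt_card h1
  obtain ⟨k, hk, rfl⟩ := Finset.mem_image.1 hs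
  exact ⟨k, hk, fun x hx e => hs' (Finset.mem_image.2 ⟨x, hx, e⟩)⟩

lemma isLow_two_mul_sub (k : ℤ) : IsLow (2 * k - k % 2) := by
  unfold IsLow
  omega

lemma exists_low_Icc {V : Type*} (B : Finset V) (c : V → ℤ) (m : ℤ) :
    ∃ s, m ≤ s ∧ s ≤ m + 2 * (B.card : ℤ) + 2 ∧ IsLow s ∧ ∀ x ∈ B, c x ≠ s := by
  obtain ⟨k, hk, hc⟩ := exists_low_avoiding
    (Finset.Icc ((m + 2) / 2) ((m + 2) / 2 + B.card)) B c (by rw [Int.card_Icc]; omega)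
  rw [Finset.mem_Icc] at hk
  exact ⟨_, by omega, by omega, isLow_two_mul_sub k, hc⟩

/-- With `|J|` from 0 to `|B|` and `y` in {3, 4, 5}, the total takes `2 * |B| + 3` consecutive
values, which contain at least `|B| + 1` low ones. -/
lemma exists_raise_free {V : Type*} [DecidableEq V] {B : Finset V} (l c : V → ℤ) (H : ℤ) :
    ∃ J ⊆ B, ∃ y : ℤ, 3 ≤ y ∧ y ≤ 5 ∧ IsLow (∑ x ∈ B, raise l J x + (H + y)) ∧
      ∀ x ∈ B, c x ≠ ∑ x ∈ B, raise l J x + (H + y) := by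
  obtain ⟨s, h1, h2, h3, h4⟩ := exists_low_Icc B c (∑ x ∈ B, l x + H + 3)
  obtain ⟨j, d, hj, hd0, hd, e⟩ : ∃ (j : ℕ) (d : ℤ), j ≤ B.card ∧ 0 ≤ d ∧ d ≤ 2 ∧
      s = ∑ x ∈ B, l x + H + 3 + 2 * j + d := by
    by_cases hs : s = ∑ x ∈ B, l x + H + 3 + 2 * (B.card : ℤ) + 2
    · exact ⟨B.card, 2, le_rfl, by norm_num, le_rfl, by omega⟩
    · exact ⟨((s - (∑ x ∈ B, l x + H + 3)) / 2).toNat, (s - (∑ x ∈ B, l x + H + 3)) % 2,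
        by omega, by omega, by omega, by omega⟩
  obtain ⟨J, hJ, hJc⟩ := Finset.exists_subset_card_eq hj
  have es : ∑ x ∈ B, raise l J x + (H + (3 + d)) = s := by
    rw [sum_raise l hJ, hJc, e]; ring
  exact ⟨J, hJ, 3 + d, by omega, by omega, es ▸ h3, es ▸ h4⟩

/-- Raising exactly one of two elements separates their values for at least one of the two choices.
-/
lemma exists_raise_ne {V : Type*} [DecidableEq V] {B : Finset V} (l : V → ℤ) {j : ℕ}
    (hj : 0 < j) (hjB : j < B.card) :
    ∃ J ⊆ B, J.card = j ∧ ∃ x ∈ B, ∃ y ∈ B, raise l J x ≠ raise l J y := by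
  obtain ⟨x, hx, y, hy, hxy⟩ := Finset.one_lt_card.1 (show 1 < B.card by omega)
  have key : ∀ x ∈ B, ∀ y ∈ B, x ≠ y → ∃ J ⊆ B, J.card = j ∧ x ∈ J ∧ y ∉ J := by
    intro x hx y hy hxy
    obtain ⟨J, h1, h2, h3⟩ := Finset.exists_subsuperset_card_eq (s := {x}) (t := B.erase y)
      (n := j) (by simp [hx, hxy]) (by rw [Finset.card_singleton]; exact hj)
      (by rw [Finset.card_erase_of_mem hy]; omega)
    exact ⟨J, h2.trans (Finset.erase_subset _ _), h3, h1 (by simp),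
      fun h => by simpa using h2 h⟩
  by_cases h : l x + 2 = l y
  · obtain ⟨J, h1, h2, h3, h4⟩ := key y hy x hx hxy.symm
    refine ⟨J, h1, h2, y, hy, x, hx, ?_⟩
    rw [raise_of_mem l h3, raise_of_notMem l h4]
    omega
  · obtain ⟨J, h1, h2, h3, h4⟩ := key x hx y hy hxy
    refine ⟨J, h1, h2, x, hx, y, hy, ?_⟩
    rw [raise_of_mem l h3, raise_of_notMem l h4]
    exact h

/-- The sums reachable with a single edge to the outside. -/
lemma exists_raise_single {V : Type*} [DecidableEq V] {B : Finset V} (hB : 2 ≤ B.card)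
    (l c : V → ℤ) {q : ℤ} (hl : ∀ x ∈ B, l x % 2 = q) :
    ∃ J ⊆ B, ∃ y : ℤ, 1 ≤ y ∧ y ≤ 5 ∧ IsLow (∑ x ∈ B, raise l J x + y) ∧
      (∀ x ∈ B, c x ≠ ∑ x ∈ B, raise l J x + y) ∧
      (y % 2 ≠ q ∨ ∃ x ∈ B, ∃ y ∈ B, raise l J x ≠ raise l J y) := by
  obtain ⟨x₀, hx₀⟩ : B.Nonempty := Finset.card_pos.1 (by omega)
  set a := ∑ x ∈ B, l x with ha
  set b := B.card with hb
  have hq : q = 0 ∨ q = 1 := by have := hl x₀ hx₀; omega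
  have haq : q = 0 → a % 2 = 0 := by
    intro h0
    rw [ha, Finset.sum_int_mod, Finset.sum_congr rfl hl, h0]
    simp
  suffices h : ∃ (s : ℤ) (j : ℕ) (y : ℤ), j ≤ b ∧ 1 ≤ y ∧ y ≤ 5 ∧ s = a + 2 * j + y ∧
      IsLow s ∧ (∀ x ∈ B, c x ≠ s) ∧ (y % 2 ≠ q ∨ 0 < j ∧ j < b) by
    obtain ⟨s, j, y, hj, hy1, hy5, e, hs, hc, h⟩ := h
    rcases h with h | ⟨h0, h1⟩
    · obtain ⟨J, hJ, hJc⟩ := Finset.exists_subset_card_eq hj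
      have es : ∑ x ∈ B, raise l J x + y = s := by rw [sum_raise l hJ, hJc, e]
      exact ⟨J, hJ, y, hy1, hy5, es ▸ hs, es ▸ hc, Or.inl h⟩
    · obtain ⟨J, hJ, hJc, hne⟩ := exists_raise_ne l h0 h1
      have es : ∑ x ∈ B, raise l J x + y = s := by rw [sum_raise l hJ, hJc, e]
      exact ⟨J, hJ, y, hy1, hy5, es ▸ hs, es ▸ hc, Or.inr hne⟩
  -- Here `y` is odd while every `l x` is even, so any `j` is allowed.
  have odd_diff : ∀ s, (∀ x ∈ B, c x ≠ s) → IsLow s → q = 0 → (s - a) % 2 = 1 → 1 ≤ s - a →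
      s - a ≤ 2 * b + 5 → ∃ (s : ℤ) (j : ℕ) (y : ℤ), j ≤ b ∧ 1 ≤ y ∧ y ≤ 5 ∧
      s = a + 2 * j + y ∧ IsLow s ∧ (∀ x ∈ B, c x ≠ s) ∧ (y % 2 ≠ q ∨ 0 < j ∧ j < b) := by
    intro s hc hs h0 h1 h2 h3
    by_cases h : s - a ≤ 2 * b + 1
    · exact ⟨s, ((s - a) / 2).toNat, 1, by omega, by omega, by omega, by omega, hs, hc, by omega⟩
    · exact ⟨s, b, s - a - 2 * b, by omega, by omega, by omega, by omega, hs, hc, by omega⟩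
  -- Here `y` is even like every `l x`, so the weights must be separated by some `0 < j < b`.
  have even_diff : ∀ s, (∀ x ∈ B, c x ≠ s) → IsLow s → q = 0 → (s - a) % 2 = 0 → 4 ≤ s - a →
      s - a ≤ 2 * b + 2 → ∃ (s : ℤ) (j : ℕ) (y : ℤ), j ≤ b ∧ 1 ≤ y ∧ y ≤ 5 ∧
      s = a + 2 * j + y ∧ IsLow s ∧ (∀ x ∈ B, c x ≠ s) ∧ (y % 2 ≠ q ∨ 0 < j ∧ j < b) := by
    intro s hc hs h0 h1 h2 h3
    by_cases h : s - a ≤ 2 * b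
    · exact ⟨s, ((s - a) / 2 - 1).toNat, 2, by omega, by omega, by omega, by omega, hs, hc,
        by omega⟩
    · exact ⟨s, b - 1, 4, by omega, by omega, by omega, by omega, hs, hc, by omega⟩
  rcases hq with h0 | h1
  · have ha2 := haq h0
    rcases (by omega : a % 4 = 0 ∨ a % 4 = 2) with h4 | h4
    · obtain ⟨k, hk, hc⟩ := exists_low_avoiding
        (Finset.Icc (a / 2 + 1) (a / 2 + 1 + b)) B c (by rw [Int.card_Icc]; omega)
      rw [Finset.mem_Icc] at hk
      rcases (by omega : k % 2 = 0 ∨ k % 2 = 1) with hk2 | hk2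
      · exact even_diff _ hc (isLow_two_mul_sub k) h0 (by omega) (by omega) (by omega)
      · exact odd_diff _ hc (isLow_two_mul_sub k) h0 (by omega) (by omega) (by omega)
    -- The differences 2, `2 * b + 4` and `2 * b + 6` are out of reach. The range starts past the
    -- first; the erased index is the even one of the top two, whose difference is one of the last
    -- two.
    · obtain ⟨k, hk, hc⟩ := exists_low_avoiding
        ((Finset.Icc (a / 2 + 2) (a / 2 + 3 + b)).erase (if b % 2 = 0 then a / 2 + 3 + b
          else a / 2 + 2 + b)) B c (by
            rw [Finset.card_erase_of_mem (by rw [Finset.mem_Icc]; split_ifs <;> omega),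
              Int.card_Icc]
            omega)
      rw [Finset.mem_erase, Finset.mem_Icc] at hk
      rcases (by omega : k % 2 = 0 ∨ k % 2 = 1) with hk2 | hk2
      · refine even_diff _ hc (isLow_two_mul_sub k) h0 (by omega) (by omega) ?_
        split_ifs at hk <;> omega
      · refine odd_diff _ hc (isLow_two_mul_sub k) h0 (by omega) (by omega) ?_
        split_ifs at hk <;> omega
  -- For odd `q` all differences from 2 to `2 * b + 4` are reachable: even ones use an even `y`, odd
  -- ones an odd `y` with `0 < j < b`.
  · obtain ⟨s, hs1, hs2, hs, hc⟩ := exists_low_Icc B c (a + 2)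
    rcases (by omega : (s - a) % 2 = 0 ∨ (s - a) % 2 = 1) with hs4 | hs4
    · by_cases h : s - a ≤ 2 * b + 2
      · exact ⟨s, ((s - a) / 2 - 1).toNat, 2, by omega, by omega, by omega, by omega, hs, hc,
          by omega⟩
      · exact ⟨s, b, 4, by omega, by omega, by omega, by omega, hs, hc, by omega⟩
    · by_cases h : s - a ≤ 2 * b + 1
      · by_cases h' : s - a ≤ 2 * b - 1
        · exact ⟨s, ((s - a) / 2).toNat, 1, by omega, by omega, by omega, by omega, hs, hc,
            by omega⟩
        · exact ⟨s, b - 1, 3, by omega, by omega, by omega, by omega, hs, hc, by omega⟩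
      · exact ⟨s, b - 1, 5, by omega, by omega, by omega, by omega, hs, hc, by omega⟩

/-- The choice of weights at a vertex with processed neighbours `B` and other neighbours `F`. -/
lemma exists_extension {V : Type*} [DecidableEq V] {B F : Finset V} (hBF : Disjoint B F)
    (hF : F.Nonempty) (l c : V → ℤ) :
    ∃ (J : Finset V) (g : V → ℤ), J ⊆ B ∧ (∀ x ∈ B, g x = raise l J x) ∧
      IsLow (∑ x ∈ B ∪ F, g x) ∧ (∀ x ∈ B, c x ≠ ∑ x ∈ B ∪ F, g x) ∧
      (∀ x ∈ F, 3 ≤ g x ∧ g x ≤ 5 ∨ 1 ≤ g x ∧ g x ≤ 5 ∧ ∀ y ∈ F, y = x) ∧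
      (3 ≤ (B ∪ F).card → ∃ x ∈ B ∪ F, ∃ y ∈ B ∪ F,
        g x % 2 ≠ g y % 2 ∨ x ∈ B ∧ y ∈ B ∧ g x ≠ g y) := by
  have hcard : (B ∪ F).card = B.card + F.card := Finset.card_union_of_disjoint hBF
  have hnB : ∀ x ∈ F, x ∉ B := fun x hx h => Finset.disjoint_left.1 hBF h hx
  -- The good case keeps one forward edge `p` free to adjust the sum, the other edges already
  -- showing both parities; switches by 2 cannot destroy this.
  by_cases hfree : (B ∪ F).card < 3 ∨ ∃ p ∈ F, ∃ h : V → ℤ, (∀ x, h x = 3 ∨ h x = 4) ∧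
      ∃ x ∈ (B ∪ F).erase p, ∃ y ∈ (B ∪ F).erase p,
        (if x ∈ B then l x else h x) % 2 ≠ (if y ∈ B then l y else h y) % 2
  · obtain ⟨p, hp, h, hh, hmix⟩ : ∃ p ∈ F, ∃ h : V → ℤ, (∀ x, h x = 3 ∨ h x = 4) ∧
      (3 ≤ (B ∪ F).card → ∃ x ∈ (B ∪ F).erase p, ∃ y ∈ (B ∪ F).erase p,
        (if x ∈ B then l x else h x) % 2 ≠ (if y ∈ B then l y else h y) % 2) := by
      rcases hfree with h3 | ⟨p, hp, h, hh, hx⟩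
      · obtain ⟨p, hp⟩ := hF
        exact ⟨p, hp, fun _ => 4, by simp, fun h => by omega⟩
      · exact ⟨p, hp, h, hh, fun _ => hx⟩
    obtain ⟨J, hJ, y, hy3, hy5, hs, hc⟩ := exists_raise_free (B := B) l c (∑ x ∈ F.erase p, h x)
    have hsum : ∑ x ∈ B ∪ F, (if x ∈ B then raise l J x else if x = p then y else h x) =
        ∑ x ∈ B, raise l J x + (∑ x ∈ F.erase p, h x + y) := by
      rw [Finset.sum_union hBF]
      congr 1
      · exact Finset.sum_congr rfl fun x hx => by simp [hx]
      · rw [← Finset.sum_erase_add _ _ hp]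
        congr 1
        · refine Finset.sum_congr rfl fun x hx => ?_
          rw [Finset.mem_erase] at hx
          simp [hnB x hx.2, hx.1]
        · simp [hnB p hp]
    refine ⟨J, fun x => if x ∈ B then raise l J x else if x = p then y else h x, hJ,
      fun x hx => by simp [hx], by rw [hsum]; exact hs, by rw [hsum]; exact hc, ?_, ?_⟩
    · intro x hx
      left
      simp only [hnB x hx, if_false]
      have := hh x
      split_ifs <;> omega
    · intro h3
      obtain ⟨x, hx, z, hz, hxz⟩ := hmix h3
      rw [Finset.mem_erase] at hx hz
      refine ⟨x, hx.2, z, hz.2, Or.inl ?_⟩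
      have h1 := raise_eq_or l J x
      have h2 := raise_eq_or l J z
      simp only [hx.1, hz.1, if_false]
      split_ifs at hxz ⊢ <;> omega
  · push Not at hfree
    obtain ⟨h3, hfree⟩ := hfree
    obtain ⟨p, hp⟩ := hF
    -- A second forward edge `q` could be given weight 3 or 4 so as to differ in parity from some
    -- other edge besides `p`.
    have hFp : ∀ y ∈ F, y = p := by
      by_contra! hne
      obtain ⟨q, hq, hqp⟩ := hne
      obtain ⟨z, hz, hzq⟩ : ∃ z ∈ (B ∪ F).erase p, z ≠ q := by
        by_contra! hall
        have : (B ∪ F).erase p ⊆ {q} := fun z hz => by simpa using hall z hz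
        have h1 := Finset.card_le_card this
        rw [Finset.card_erase_of_mem (by simp [hp]), Finset.card_singleton] at h1
        omega
      have hz' := hz
      rw [Finset.mem_erase] at hz
      have hqm : q ∈ (B ∪ F).erase p := by simp [hqp, hq]
      by_cases hzB : z ∈ B
      · have := hfree p hp (fun _ => if l z % 2 = 0 then 3 else 4)
          (fun _ => by split_ifs <;> simp) z hz' q hqm
        simp only [hzB, hnB q hq, if_true, if_false] at this
        split_ifs at this <;> omega
      · have := hfree p hp (fun x => if x = q then 3 else 4)
          (fun _ => by split_ifs <;> simp) z hz' q hqm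
        simp only [hzB, hnB q hq, hzq, if_true, if_false] at this
        omega
    have hFs : F = {p} := Finset.eq_singleton_iff_unique_mem.2 ⟨hp, hFp⟩
    have hF1 : F.card = 1 := by rw [hFs, Finset.card_singleton]
    have hB2 : 2 ≤ B.card := by omega
    obtain ⟨x₀, hx₀⟩ : B.Nonempty := Finset.card_pos.1 (by omega)
    have hne : ∀ x ∈ B, x ≠ p := fun x hx e => hnB p hp (e ▸ hx)
    have hl : ∀ x ∈ B, l x % 2 = l x₀ % 2 := by
      intro x hx
      have := hfree p hp (fun _ => 4) (by simp) x (by simp [hx, hne x hx]) x₀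
        (by simp [hx₀, hne x₀ hx₀])
      simpa [hx, hx₀] using this
    obtain ⟨J, hJ, y, hy1, hy5, hs, hc, hmix⟩ := exists_raise_single hB2 l c hl
    have hsum : ∑ x ∈ B ∪ F, (if x ∈ B then raise l J x else y) =
        ∑ x ∈ B, raise l J x + y := by
      rw [Finset.sum_union hBF, hFs, Finset.sum_singleton, if_neg (hnB p hp)]
      congr 1
      exact Finset.sum_congr rfl fun x hx => by simp [hx]
    refine ⟨J, fun x => if x ∈ B then raise l J x else y, hJ,
      fun x hx => by simp [hx], by rw [hsum]; exact hs, by rw [hsum]; exact hc, ?_, ?_⟩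
    · intro x hx
      right
      simp only [hnB x hx, if_false]
      exact ⟨hy1, hy5, fun z hz => (hFp z hz).trans (hFp x hx).symm⟩
    · intro _
      rcases hmix with h | ⟨x, hx, z, hz, hxz⟩
      · refine ⟨x₀, by simp [hx₀], p, by simp [hp], Or.inl ?_⟩
        have h1 := raise_eq_or l J x₀
        simp only [hx₀, hnB p hp, if_true, if_false]
        omega
      · exact ⟨x, by simp [hx], z, by simp [hz], Or.inr ⟨hx, hz, by simpa [hx, hz] using hxz⟩⟩

/-- The last vertex of a component can be given a sum different from those of its neighbours. -/
lemma exists_raise_root {V : Type*} [DecidableEq V] {B : Finset V} (hB : 2 ≤ B.card)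
    (l c : V → ℤ) (hc : ∀ x ∈ B, IsLow (c x)) :
    ∃ J ⊆ B, ∀ x ∈ B, raise c J x ≠ ∑ x ∈ B, raise l J x := by
  set a := ∑ x ∈ B, l x with ha
  unfold IsLow at hc
  by_cases hlow : IsLow a
  · unfold IsLow at hlow
    by_cases h : ∀ x ∈ B, c x = a
    · obtain ⟨J, hJ, hJ2⟩ := Finset.exists_subset_card_eq hB
      refine ⟨J, hJ, fun x hx => ?_⟩
      rw [sum_raise l hJ, hJ2]
      have := raise_eq_or c J x
      have := h x hx
      omega
    -- Raising only `i` makes the total `a + 2`, which is not low; the only raised neighbour has `c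
    -- i + 2 ≠ a + 2`.
    · push Not at h
      obtain ⟨i, hi, hia⟩ := h
      have hJ : {i} ⊆ B := by simpa using hi
      refine ⟨{i}, hJ, fun x hx => ?_⟩
      rw [sum_raise l hJ, Finset.card_singleton]
      have := hc x hx
      by_cases h : x = i
      · subst h
        rw [raise_of_mem c (by simp)]
        omega
      · rw [raise_of_notMem c (by simpa using h)]
        omega
  · refine ⟨∅, by simp, fun x hx => ?_⟩
    rw [sum_raise l (by simp), raise_of_notMem c (by simp)]
    unfold IsLow at hlow
    have := hc x hx
    simp only [Finset.card_empty]
    omega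

/-- If the last vertex has degree at least `4`, it can moreover see two different weights. -/
lemma exists_raise_root_ne {V : Type*} [DecidableEq V] {B : Finset V} (hB : 4 ≤ B.card)
    (l c : V → ℤ) (hc : ∀ x ∈ B, IsLow (c x)) :
    ∃ J ⊆ B, (∀ x ∈ B, raise c J x ≠ ∑ x ∈ B, raise l J x) ∧
      ∃ x ∈ B, ∃ y ∈ B, raise l J x ≠ raise l J y := by
  set a := ∑ x ∈ B, l x with ha
  unfold IsLow at hc
  have other : ∀ i j : V, ∃ m ∈ B, m ≠ i ∧ m ≠ j := by
    intro i j
    by_contra! h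
    have h1 : B ⊆ {i, j} := fun m hm => by
      by_cases e : m = i
      · simp [e]
      · simp [h m hm e]
    have := (Finset.card_le_card h1).trans Finset.card_le_two
    omega
  by_cases hlow : IsLow a
  · unfold IsLow at hlow
    by_cases h : ∀ x ∈ B, c x = a
    · obtain ⟨J, hJ, hJ2, hne⟩ := exists_raise_ne (B := B) l (j := 2) (by norm_num) (by omega)
      refine ⟨J, hJ, fun x hx => ?_, hne⟩
      rw [sum_raise l hJ, hJ2]
      have := raise_eq_or c J x
      have := h x hx
      omega
    push Not at h
    obtain ⟨i, hi, hia⟩ := h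
    have single : ∀ i ∈ B, c i ≠ a → ∀ x ∈ B, raise c {i} x ≠ ∑ x ∈ B, raise l {i} x := by
      intro i hi hia x hx
      rw [sum_raise l (by simpa using hi), Finset.card_singleton]
      have := hc x hx
      by_cases h : x = i
      · subst h
        rw [raise_of_mem c (by simp)]
        omega
      · rw [raise_of_notMem c (by simpa using h)]
        omega
    -- Raising `i` alone fails only if it levels all weights, that is, if `l m = l i + 2` for every
    -- other `m`.
    by_cases hbad : ∃ m ∈ B, m ≠ i ∧ l m ≠ l i + 2
    · obtain ⟨m, hm, hmi, hml⟩ := hbad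
      refine ⟨{i}, by simpa using hi, single i hi hia, m, hm, i, hi, ?_⟩
      rwa [raise_of_notMem l (by simpa using hmi), raise_of_mem l (by simp)]
    push Not at hbad
    by_cases h2 : ∃ m ∈ B, m ≠ i ∧ c m ≠ a
    · obtain ⟨m, hm, hmi, hma⟩ := h2
      refine ⟨{m}, by simpa using hm, single m hm hma, i, hi, m, hm, ?_⟩
      rw [raise_of_notMem l (by simpa using hmi.symm), raise_of_mem l (by simp),
        hbad m hm hmi]
      omega
    push Not at h2
    -- Now `c` equals `a` except at `i`. Raising `i` and `m` gives total `a + 4`, with weights `l i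
    -- + 2` and `l i + 4` on these two edges.
    obtain ⟨m, hm, hmi, -⟩ := other i i
    have hJ : {i, m} ⊆ B := by
      intro x hx
      rcases (by simpa using hx : x = i ∨ x = m) with rfl | rfl <;> assumption
    refine ⟨{i, m}, hJ, fun x hx => ?_, i, hi, m, hm, ?_⟩
    · rw [sum_raise l hJ, Finset.card_pair hmi.symm]
      have := raise_eq_or c {i, m} x
      by_cases hxi : x = i
      · subst hxi
        rw [raise_of_mem c (by simp)]
        have := hc x hx
        push_cast
        omega
      · have := h2 x hx hxi
        push_cast
        omega
    · rw [raise_of_mem l (by simp), raise_of_mem l (by simp), hbad m hm hmi]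
      omega
  unfold IsLow at hlow
  by_cases hl : ∃ x ∈ B, ∃ y ∈ B, l x ≠ l y
  · obtain ⟨x, hx, y, hy, hxy⟩ := hl
    refine ⟨∅, by simp, fun x hx => ?_, x, hx, y, hy, ?_⟩
    · rw [sum_raise l (by simp), raise_of_notMem c (by simp)]
      have := hc x hx
      simp only [Finset.card_empty]
      omega
    · rwa [raise_of_notMem l (by simp), raise_of_notMem l (by simp)]
  push Not at hl
  by_cases h2 : ∃ i ∈ B, ∃ m ∈ B, i ≠ m ∧ c i ≠ a + 2 ∧ c m ≠ a + 2
  · obtain ⟨i, hi, m, hm, him, hia, hma⟩ := h2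
    have hJ : {i, m} ⊆ B := by
      intro x hx
      rcases (by simpa using hx : x = i ∨ x = m) with rfl | rfl <;> assumption
    obtain ⟨n, hn, hni, hnm⟩ := other i m
    refine ⟨{i, m}, hJ, fun x hx => ?_, i, hi, n, hn, ?_⟩
    · rw [sum_raise l hJ, Finset.card_pair him]
      have := hc x hx
      push_cast
      by_cases hxJ : x ∈ ({i, m} : Finset V)
      · rw [raise_of_mem c hxJ]
        rcases (by simpa using hxJ : x = i ∨ x = m) with rfl | rfl <;> omega
      · rw [raise_of_notMem c hxJ]
        omega
    · rw [raise_of_mem l (by simp), raise_of_notMem l (by simp [hni, hnm]), hl i hi n hn]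
      omega
  push Not at h2
  -- At most one neighbour has `c x ≠ a + 2`; put it in `J`. The total `a + 6` is low, hence no
  -- raised sum, and every unraised neighbour has sum `a + 2`. As `|B| ≥ 4`, some edge stays
  -- unraised.
  obtain ⟨J, hNJ, hJ, hJ3⟩ := Finset.exists_subsuperset_card_eq
    (Finset.filter_subset (fun x => c x ≠ a + 2) B) (n := 3) (by
      refine (Finset.card_le_one.2 fun x hx y hy => ?_).trans (by norm_num)
      rw [Finset.mem_filter] at hx hy
      by_contra hxy
      exact hy.2 (h2 x hx.1 y hy.1 hxy hx.2)) (by omega)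
  obtain ⟨y, hy, hyJ⟩ := Finset.exists_mem_notMem_of_card_lt_card (show J.card < B.card by omega)
  obtain ⟨x, hx⟩ := Finset.card_pos.1 (show 0 < J.card by omega)
  refine ⟨J, hJ, fun z hz => ?_, x, hJ hx, y, hy, ?_⟩
  · rw [sum_raise l hJ, hJ3]
    have := hc z hz
    push_cast
    by_cases hzJ : z ∈ J
    · rw [raise_of_mem c hzJ]
      omega
    · have : c z = a + 2 := by
        by_contra hne
        exact hzJ (hNJ (Finset.mem_filter.2 ⟨hz, hne⟩))
      rw [raise_of_notMem c hzJ]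
      omega
  · rw [raise_of_mem l hx, raise_of_notMem l hyJ, hl x (hJ hx) y hy]
    omega

/-! ### Processing the vertices one at a time. -/

section
variable {V : Type*} [DecidableEq V]

/-- Replace the weights of the pairs containing `v` by those given by `g`. -/
def reweight (w : V → V → ℤ) (v : V) (g : V → ℤ) (x y : V) : ℤ :=
  if x = v then g y else if y = v then g x else w x y

lemma reweight_symm {w : V → V → ℤ} (hw : ∀ x y, w x y = w y x) (v : V) (g : V → ℤ) (x y : V) :
    reweight w v g x y = reweight w v g y x := by
  unfold reweight
  split_ifs with h1 h2 <;> simp_all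

lemma reweight_left (w : V → V → ℤ) (v : V) (g : V → ℤ) (y : V) :
    reweight w v g v y = g y := by simp [reweight]

lemma reweight_right (w : V → V → ℤ) {v : V} (g : V → ℤ) {x : V} (h : x ≠ v) :
    reweight w v g x v = g x := by simp [reweight, h]

lemma reweight_of_ne (w : V → V → ℤ) {v : V} (g : V → ℤ) {x y : V} (hx : x ≠ v) (hy : y ≠ v) :
    reweight w v g x y = w x y := by simp [reweight, hx, hy]

end

section
variable {V : Type*} [Fintype V] (G : SimpleGraph V) [DecidableRel G.Adj]

/-- The sum of the weights `w v u` over the neighbours `u` of `v`. -/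
def wsum (w : V → V → ℤ) (v : V) : ℤ := ∑ u ∈ G.neighborFinset v, w v u

/-- The invariant of the weighting procedure: the vertices of `S` have been processed, the vertex
`x ∈ S` keeps its sum in `{c x, c x + 2}`, and `ε x` is the current offset. -/
structure State (S : Finset V) (w : V → V → ℤ) (c ε : V → ℤ) : Prop where
  symm : ∀ x y, w x y = w y x
  bound : ∀ x ∈ S, ∀ y ∈ S, G.Adj x y → 1 ≤ w x y ∧ w x y ≤ 7
  offset : ∀ x ∈ S, ε x = 0 ∨ ε x = 2
  low : ∀ x ∈ S, IsLow (c x)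
  sum : ∀ x ∈ S, wsum G w x = c x + ε x
  ne : ∀ x ∈ S, ∀ y ∈ S, G.Adj x y → c x ≠ c y
  out : ∀ x ∈ S, ∀ y ∉ S, G.Adj x y → 3 ≤ w x y ∧ w x y ≤ 5 ∨
    1 ≤ w x y ∧ w x y ≤ 5 ∧ ε x = 0 ∧ ∀ z ∉ S, G.Adj x z → z = y
  mix : ∀ x ∈ S, 3 ≤ G.degree x → ∃ y ∈ G.neighborFinset x, ∃ z ∈ G.neighborFinset x,
    w x y % 2 ≠ w x z % 2 ∨ y ∈ S ∧ z ∈ S ∧ w x y ≠ w x z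

variable {G} {S : Finset V} {w : V → V → ℤ} {c ε : V → ℤ} {v : V}

/-- This is the purpose of the `out` clause: the lower of the two weights lies in 1, …, 5, so the
higher one is at most 7. Weights 1 and 2 occur only on a last outgoing edge, with offset still 0. -/
lemma State.lower (h : State G S w c ε) (hv : v ∉ S) {x : V} (hx : x ∈ S) (hxv : G.Adj x v) :
    1 ≤ w x v - ε x ∧ w x v - ε x ≤ 5 := by
  have h1 := h.offset x hx
  have h2 := h.out x hx v hv hxv
  omega

end

section
variable {V : Type*} [Fintype V] [DecidableEq V] (G : SimpleGraph V) [DecidableRel G.Adj]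

lemma wsum_reweight_self (w : V → V → ℤ) (v : V) (g : V → ℤ) :
    wsum G (reweight w v g) v = ∑ u ∈ G.neighborFinset v, g u :=
  Finset.sum_congr rfl fun u _ => reweight_left w v g u

lemma wsum_reweight_of_not_adj (w : V → V → ℤ) {v x : V} (g : V → ℤ) (hx : x ≠ v)
    (h : ¬ G.Adj x v) : wsum G (reweight w v g) x = wsum G w x :=
  Finset.sum_congr rfl fun u hu => reweight_of_ne w g hx fun e => h <| by
    rw [SimpleGraph.mem_neighborFinset] at hu
    exact e ▸ hu

lemma wsum_reweight_of_adj (w : V → V → ℤ) {v x : V} (g : V → ℤ) (h : G.Adj x v) :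
    wsum G (reweight w v g) x = wsum G w x - w x v + g x := by
  have hv : v ∈ G.neighborFinset x := by simpa using h
  unfold wsum
  rw [← Finset.sum_erase_add _ _ hv, ← Finset.sum_erase_add _ (fun u => w x u) hv,
    reweight_right w g h.ne, Finset.sum_congr rfl fun u hu =>
      reweight_of_ne w g h.ne (Finset.ne_of_mem_erase hu)]
  ring

variable {G}
variable {S : Finset V} {w : V → V → ℤ} {c ε : V → ℤ} {v : V} {J : Finset V} {g : V → ℤ}

/-- The offsets after the edges from `v` to `J` have been raised. -/
def newOffset (G : SimpleGraph V) [DecidableRel G.Adj] (ε : V → ℤ) (v : V) (J : Finset V)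
    (x : V) : ℤ :=
  if G.Adj x v then (if x ∈ J then 2 else 0) else ε x

lemma State.sum_reweight (h : State G S w c ε) (hv : v ∉ S)
    (hg : ∀ x ∈ S, G.Adj x v → g x = raise (fun x => w x v - ε x) J x) {x : V} (hx : x ∈ S) :
    wsum G (reweight w v g) x = c x + newOffset G ε v J x := by
  have hxv : x ≠ v := fun e => hv (e ▸ hx)
  have h1 := h.sum x hx
  by_cases ha : G.Adj x v
  · rw [wsum_reweight_of_adj G w g ha, hg x hx ha, h1]
    simp only [newOffset, raise, ha, if_true]
    ring
  · rw [wsum_reweight_of_not_adj G w g hxv ha, h1]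
    simp [newOffset, ha]

lemma State.bound_reweight (h : State G S w c ε) (hv : v ∉ S)
    (hg : ∀ x ∈ S, G.Adj x v → g x = raise (fun x => w x v - ε x) J x) {x : V} (hx : x ∈ S)
    (ha : G.Adj x v) : 1 ≤ g x ∧ g x ≤ 7 := by
  rw [hg x hx ha]
  have h1 := h.lower hv hx ha
  have h2 := raise_eq_or (fun x => w x v - ε x) J x
  omega

lemma State.bound_reweight_insert (h : State G S w c ε) (hv : v ∉ S)
    (hg : ∀ x ∈ S, G.Adj x v → g x = raise (fun x => w x v - ε x) J x) :
    ∀ x ∈ insert v S, ∀ y ∈ insert v S, G.Adj x y →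
      1 ≤ reweight w v g x y ∧ reweight w v g x y ≤ 7 := by
  intro x hx y hy ha
  rw [Finset.mem_insert] at hx hy
  by_cases hxv : x = v
  · subst hxv
    rw [reweight_left]
    exact h.bound_reweight hv hg (hy.resolve_left ha.ne') ha.symm
  · by_cases hyv : y = v
    · subst hyv
      rw [reweight_right w g hxv]
      exact h.bound_reweight hv hg (hx.resolve_left hxv) ha
    · rw [reweight_of_ne w g hxv hyv]
      exact h.bound x (hx.resolve_left hxv) y (hy.resolve_left hyv) ha

/-- An edge from `x` to `v` changes by `-ε x` plus 0 or 2, an even amount, and edges inside `S` do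
not change. -/
lemma State.mix_reweight (h : State G S w c ε) (hv : v ∉ S)
    (hg : ∀ x ∈ S, G.Adj x v → g x = raise (fun x => w x v - ε x) J x) {x : V} (hx : x ∈ S)
    (hd : 3 ≤ G.degree x) : ∃ y ∈ G.neighborFinset x, ∃ z ∈ G.neighborFinset x,
      reweight w v g x y % 2 ≠ reweight w v g x z % 2 ∨
        y ∈ S ∧ z ∈ S ∧ reweight w v g x y ≠ reweight w v g x z := by
  have hxv : x ≠ v := fun e => hv (e ▸ hx)
  have par : ∀ y, G.Adj x y → reweight w v g x y % 2 = w x y % 2 := by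
    intro y hy
    by_cases hyv : y = v
    · subst hyv
      rw [reweight_right w g hxv, hg x hx hy]
      have h1 := h.offset x hx
      have h2 := raise_eq_or (fun x => w x y - ε x) J x
      omega
    · rw [reweight_of_ne w g hxv hyv]
  obtain ⟨y, hy, z, hz, hyz⟩ := h.mix x hx hd
  refine ⟨y, hy, z, hz, hyz.imp (fun e => ?_) fun ⟨h1, h2, h3⟩ => ⟨h1, h2, ?_⟩⟩
  · rw [SimpleGraph.mem_neighborFinset] at hy hz
    rwa [par y hy, par z hz]
  · rwa [reweight_of_ne w g hxv fun e => hv (e ▸ h1),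
      reweight_of_ne w g hxv fun e => hv (e ▸ h2)]

lemma State.step (h : State G S w c ε) (hv : v ∉ S) (hp : ∃ p ∉ S, G.Adj v p) :
    ∃ w' c' ε', State G (insert v S) w' c' ε' := by
  set B := (G.neighborFinset v).filter (· ∈ S) with hB
  set F := (G.neighborFinset v).filter (· ∉ S) with hF
  have hBF : B ∪ F = G.neighborFinset v := Finset.filter_union_filter_not_eq _ _
  have hmB : ∀ x, x ∈ B ↔ G.Adj v x ∧ x ∈ S := by simp [hB]
  have hmF : ∀ x, x ∈ F ↔ G.Adj v x ∧ x ∉ S := by simp [hF]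
  obtain ⟨J, g, hJ, hg, hlow, hne, hout, hmix⟩ := exists_extension (B := B) (F := F)
    (Finset.disjoint_filter_filter_not _ _ _)
    (by obtain ⟨p, hp, hvp⟩ := hp; exact ⟨p, (hmF p).2 ⟨hvp, hp⟩⟩) (fun x => w x v - ε x) c
  rw [hBF] at hlow hne hmix
  have hg' : ∀ x ∈ S, G.Adj x v → g x = raise (fun x => w x v - ε x) J x :=
    fun x hx ha => hg x ((hmB x).2 ⟨ha.symm, hx⟩)
  have hxv : ∀ x ∈ S, x ≠ v := fun x hx e => hv (e ▸ hx)
  refine ⟨reweight w v g, Function.update c v (∑ x ∈ G.neighborFinset v, g x),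
    Function.update (newOffset G ε v J) v 0, reweight_symm h.symm v g,
    h.bound_reweight_insert hv hg', ?_, ?_, ?_, ?_, ?_, ?_⟩
  · intro x hx
    rcases Finset.mem_insert.1 hx with rfl | hx
    · simp
    · rw [Function.update_of_ne (hxv x hx), newOffset]
      have := h.offset x hx
      split_ifs <;> simp_all
  · intro x hx
    rcases Finset.mem_insert.1 hx with rfl | hx
    · simpa using hlow
    · rw [Function.update_of_ne (hxv x hx)]
      exact h.low x hx
  · intro x hx
    rcases Finset.mem_insert.1 hx with rfl | hx
    · simp [wsum_reweight_self]
    · rw [Function.update_of_ne (hxv x hx), Function.update_of_ne (hxv x hx)]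
      exact h.sum_reweight hv hg' hx
  · intro x hx y hy ha
    rcases Finset.mem_insert.1 hx with rfl | hx
    · have hy := (Finset.mem_insert.1 hy).resolve_left ha.ne'
      rw [Function.update_self, Function.update_of_ne (hxv y hy)]
      exact (hne y ((hmB y).2 ⟨ha, hy⟩)).symm
    · rw [Function.update_of_ne (hxv x hx)]
      rcases Finset.mem_insert.1 hy with e | hy
      · rw [e] at ha ⊢
        rw [Function.update_self]
        exact hne x ((hmB x).2 ⟨ha.symm, hx⟩)
      · rw [Function.update_of_ne (hxv y hy)]
        exact h.ne x hx y hy ha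
  · intro x hx y hy ha
    rw [Finset.mem_insert, not_or] at hy
    rcases Finset.mem_insert.1 hx with rfl | hx
    · rw [reweight_left]
      refine (hout y ((hmF y).2 ⟨ha, hy.2⟩)).imp id fun ⟨h1, h2, h3⟩ => ⟨h1, h2, by simp, ?_⟩
      intro z hz haz
      rw [Finset.mem_insert, not_or] at hz
      exact h3 z ((hmF z).2 ⟨haz, hz.2⟩)
    · rw [reweight_of_ne w g (hxv x hx) hy.1, Function.update_of_ne (hxv x hx)]
      refine (h.out x hx y hy.2 ha).imp id fun ⟨h1, h2, h3, h4⟩ => ⟨h1, h2, ?_, ?_⟩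
      · have : ¬ G.Adj x v := fun hav => hy.1 (h4 v hv hav).symm
        simp [newOffset, this, h3]
      · intro z hz haz
        rw [Finset.mem_insert, not_or] at hz
        exact h4 z hz.2 haz
  · intro x hx hd
    rcases Finset.mem_insert.1 hx with rfl | hx
    · obtain ⟨y, hy, z, hz, hyz⟩ := hmix (by rwa [SimpleGraph.card_neighborFinset_eq_degree])
      refine ⟨y, hy, z, hz, ?_⟩
      rw [reweight_left, reweight_left]
      exact hyz.imp id fun ⟨h1, h2, h3⟩ => ⟨Finset.mem_insert_of_mem ((hmB y).1 h1).2,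
        Finset.mem_insert_of_mem ((hmB z).1 h2).2, h3⟩
    · obtain ⟨y, hy, z, hz, hyz⟩ := h.mix_reweight hv hg' hx hd
      exact ⟨y, hy, z, hz, hyz.imp id fun ⟨h1, h2, h3⟩ => ⟨Finset.mem_insert_of_mem h1,
        Finset.mem_insert_of_mem h2, h3⟩⟩

lemma State.finish (h : State G S w c ε) (hv : v ∉ S) (hN : ∀ x, G.Adj v x → x ∈ S)
    (hd : 2 ≤ G.degree v) :
    ∃ w' : V → V → ℤ, (∀ x y, w' x y = w' y x) ∧
      (∀ x ∈ insert v S, ∀ y ∈ insert v S, G.Adj x y →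
        1 ≤ w' x y ∧ w' x y ≤ 7 ∧ wsum G w' x ≠ wsum G w' y) ∧
      ∀ x ∈ insert v S, 3 ≤ G.degree x → (x = v → 4 ≤ G.degree x) →
        ∃ y ∈ G.neighborFinset x, ∃ z ∈ G.neighborFinset x, w' x y ≠ w' x z := by
  have hmN : ∀ x ∈ G.neighborFinset v, x ∈ S := fun x hx => hN x (by simpa using hx)
  rw [← SimpleGraph.card_neighborFinset_eq_degree] at hd
  obtain ⟨J, -, hdist, hmono⟩ : ∃ J ⊆ G.neighborFinset v,
      (∀ x ∈ G.neighborFinset v, raise c J x ≠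
        ∑ x ∈ G.neighborFinset v, raise (fun x => w x v - ε x) J x) ∧
      (4 ≤ (G.neighborFinset v).card → ∃ x ∈ G.neighborFinset v, ∃ y ∈ G.neighborFinset v,
        raise (fun x => w x v - ε x) J x ≠ raise (fun x => w x v - ε x) J y) := by
    by_cases h4 : 4 ≤ (G.neighborFinset v).card
    · obtain ⟨J, h1, h2, h3⟩ := exists_raise_root_ne h4 (fun x => w x v - ε x) c
        fun x hx => h.low x (hmN x hx)
      exact ⟨J, h1, h2, fun _ => h3⟩
    · obtain ⟨J, h1, h2⟩ := exists_raise_root hd (fun x => w x v - ε x) c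
        fun x hx => h.low x (hmN x hx)
      exact ⟨J, h1, h2, fun h => absurd h h4⟩
  set g := raise (fun x => w x v - ε x) J with hg
  have hg' : ∀ x ∈ S, G.Adj x v → g x = raise (fun x => w x v - ε x) J x := fun _ _ _ => rfl
  have hroot : ∀ x ∈ S, G.Adj x v → wsum G (reweight w v g) x ≠ wsum G (reweight w v g) v := by
    intro x hx ha
    rw [h.sum_reweight hv hg' hx, wsum_reweight_self]
    have := hdist x (by simpa using ha.symm)
    simpa [newOffset, ha, raise] using this
  refine ⟨reweight w v g, reweight_symm h.symm v g, fun x hx y hy ha => ?_, fun x hx hdx hxv => ?_⟩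
  · refine (h.bound_reweight_insert hv hg' x hx y hy ha).imp id fun h7 => ⟨h7, ?_⟩
    rw [Finset.mem_insert] at hx hy
    by_cases hxv : x = v
    · subst hxv
      exact (hroot y (hy.resolve_left ha.ne') ha.symm).symm
    · by_cases hyv : y = v
      · subst hyv
        exact hroot x (hx.resolve_left hxv) ha
      · have hx := hx.resolve_left hxv
        have hy := hy.resolve_left hyv
        rw [h.sum_reweight hv hg' hx, h.sum_reweight hv hg' hy]
        -- Both offsets are 0 or 2 and the low values differ, so the sums lie in disjoint pairs.
        have off : ∀ x ∈ S, newOffset G ε v J x = 0 ∨ newOffset G ε v J x = 2 := by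
          intro x hx
          have := h.offset x hx
          unfold newOffset
          split_ifs <;> simp_all
        have h1 := h.low x hx
        have h2 := h.low y hy
        have h3 := off x hx
        have h4 := off y hy
        have h5 := h.ne x hx y hy ha
        unfold IsLow at h1 h2
        omega
  · rcases Finset.mem_insert.1 hx with rfl | hx
    · obtain ⟨y, hy, z, hz, hyz⟩ := hmono (by
        rw [SimpleGraph.card_neighborFinset_eq_degree]; exact hxv rfl)
      exact ⟨y, hy, z, hz, by rwa [reweight_left, reweight_left]⟩
    · obtain ⟨y, hy, z, hz, hyz⟩ := h.mix_reweight hv hg' hx hdx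
      exact ⟨y, hy, z, hz, hyz.elim (fun h e => h (by rw [e])) fun h => h.2.2⟩

end

/-! ### Weighting one component. -/

lemma exists_adj_dist_lt {V : Type*} {G : SimpleGraph V} {r v : V} (h : G.Reachable r v)
    (hv : v ≠ r) : ∃ p, G.Adj v p ∧ G.Reachable r p ∧ G.dist r p < G.dist r v := by
  obtain ⟨W, hW⟩ := h.symm.exists_walk_length_eq_dist
  cases W with
  | nil => exact absurd rfl hv
  | cons ha W' =>
    refine ⟨_, ha, ⟨W'.reverse⟩, ?_⟩
    rw [G.dist_comm, G.dist_comm (u := r), ← hW, SimpleGraph.Walk.length_cons]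
    exact Nat.lt_succ_of_le (SimpleGraph.dist_le W')

section
variable {V : Type*} [Fintype V] [DecidableEq V] {G : SimpleGraph V} [DecidableRel G.Adj]

/-- Always taking a farthest unprocessed vertex keeps processed vertices at least as far from `r` as
unprocessed ones, so a neighbour closer to `r` is still unprocessed. -/
lemma exists_state {r : V} {C : Finset V} (hC : ∀ x, x ∈ C ↔ G.Reachable r x) :
    ∃ w c ε, State G (C.erase r) w c ε := by
  have key : ∀ n, n ≤ (C.erase r).card → ∃ S ⊆ C.erase r, S.card = n ∧
      (∀ x ∈ S, ∀ y ∈ C, y ∉ S → G.dist r y ≤ G.dist r x) ∧ ∃ w c ε, State G S w c ε := by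
    intro n
    induction n with
    | zero =>
      intro _
      exact ⟨∅, by simp, rfl, by simp, fun _ _ => 0, 0, 0, by constructor <;> simp⟩
    | succ n ih =>
      intro hn
      obtain ⟨S, hS, hSn, hdist, w, c, ε, h⟩ := ih (by omega)
      have hne : (C.erase r \ S).Nonempty := by
        rw [← Finset.card_pos, Finset.card_sdiff_of_subset hS]
        omega
      obtain ⟨v, hv, hmax⟩ := Finset.exists_max_image _ (fun v => G.dist r v) hne
      rw [Finset.mem_sdiff, Finset.mem_erase] at hv
      obtain ⟨p, hvp, hp, hlt⟩ := exists_adj_dist_lt ((hC v).1 hv.1.2) hv.1.1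
      refine ⟨insert v S, Finset.insert_subset (Finset.mem_erase.2 hv.1) hS,
        by rw [Finset.card_insert_of_notMem hv.2, hSn], ?_,
        h.step hv.2 ⟨p, fun hpS => absurd (hdist p hpS v hv.1.2 hv.2) (by omega), hvp⟩⟩
      intro x hx y hy hyS
      rw [Finset.mem_insert, not_or] at hyS
      rcases Finset.mem_insert.1 hx with rfl | hx
      · by_cases hyr : y = r
        · simp [hyr]
        · exact hmax y (Finset.mem_sdiff.2 ⟨Finset.mem_erase.2 ⟨hyr, hy⟩, hyS.2⟩)
      · exact hdist x hx y hy hyS.2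
  obtain ⟨S, hS, hSn, -, h⟩ := key _ le_rfl
  rwa [Finset.eq_of_subset_of_card_le hS hSn.ge] at h

/-- In a graph of maximum degree at most `3`, a vertex of degree `3` seeing a single weight can be
repaired by changing the weight of one edge. -/
lemma exists_repair {C : Finset V} {w : V → V → ℤ} {r : V} (hd : ∀ x, G.degree x ≤ 3)
    (hC : ∀ x ∈ C, ∀ y, G.Adj x y → y ∈ C) (hr : r ∈ C) (hr3 : G.degree r = 3)
    (hsymm : ∀ x y, w x y = w y x)
    (hw : ∀ x ∈ C, ∀ y ∈ C, G.Adj x y →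
      1 ≤ w x y ∧ w x y ≤ 7 ∧ wsum G w x ≠ wsum G w y)
    (hmix : ∀ x ∈ C, G.degree x = 3 → x ≠ r →
      ∃ y ∈ G.neighborFinset x, ∃ z ∈ G.neighborFinset x, w x y ≠ w x z)
    (hmono : ∀ y ∈ G.neighborFinset r, ∀ z ∈ G.neighborFinset r, w r y = w r z) :
    ∃ w' : V → V → ℤ, (∀ x y, w' x y = w' y x) ∧
      (∀ x ∈ C, ∀ y ∈ C, G.Adj x y →
        1 ≤ w' x y ∧ w' x y ≤ 7 ∧ wsum G w' x ≠ wsum G w' y) ∧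
      ∀ x ∈ C, G.degree x = 3 →
        ∃ y ∈ G.neighborFinset x, ∃ z ∈ G.neighborFinset x, w' x y ≠ w' x z := by
  obtain ⟨q, hq⟩ : (G.neighborFinset r).Nonempty := by
    rw [← Finset.card_pos, SimpleGraph.card_neighborFinset_eq_degree]
    omega
  have hrq : G.Adj r q := by simpa using hq
  have hrmem : r ∈ G.neighborFinset q := by simpa using hrq.symm
  have card2 : ∀ x y, y ∈ G.neighborFinset x → ((G.neighborFinset x).erase y).card ≤ 2 := by
    intro x y hy
    rw [Finset.card_erase_of_mem hy, SimpleGraph.card_neighborFinset_eq_degree]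
    have := hd x
    omega
  obtain ⟨m, hm⟩ : ∃ m : ℤ, G.degree q = 3 → ∃ z ∈ G.neighborFinset q, z ≠ r ∧ w q z = m := by
    by_cases h3 : G.degree q = 3
    · obtain ⟨z, hz⟩ : ((G.neighborFinset q).erase r).Nonempty := by
        rw [← Finset.card_pos, Finset.card_erase_of_mem hrmem,
          SimpleGraph.card_neighborFinset_eq_degree]
        omega
      rw [Finset.mem_erase] at hz
      exact ⟨w q z, fun _ => ⟨z, hz.2, hz.1, rfl⟩⟩
    · exact ⟨0, fun h => absurd h h3⟩
  -- At most six values are forbidden for the edge `rq`: two from the other neighbours of `q`, two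
  -- from those of `r`, the old weight, and a weight `m` seen elsewhere by `q`. The sums of `r` and
  -- `q` shift equally and stay distinct.
  obtain ⟨t, ht, htE⟩ : ∃ t ∈ Finset.Icc (1 : ℤ) 7, t ∉
      ((G.neighborFinset q).erase r).image (fun y => wsum G w y - wsum G w q + w q r) ∪
      (((G.neighborFinset r).erase q).image (fun y => wsum G w y - wsum G w r + w r q) ∪
        {w r q, m}) := by
    apply Finset.exists_mem_notMem_of_card_lt_card
    rw [Int.card_Icc]
    have h1 := (Finset.card_image_le (s := (G.neighborFinset q).erase r)
      (f := fun y => wsum G w y - wsum G w q + w q r)).trans (card2 q r hrmem)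
    have h2 := (Finset.card_image_le (s := (G.neighborFinset r).erase q)
      (f := fun y => wsum G w y - wsum G w r + w r q)).trans (card2 r q hq)
    have h3 := Finset.card_le_two (a := w r q) (b := m)
    refine ((Finset.card_union_le _ _).trans
      (add_le_add h1 ((Finset.card_union_le _ _).trans (add_le_add h2 h3)))).trans_lt (by simp)
  rw [Finset.mem_Icc] at ht
  simp only [Finset.mem_union, Finset.mem_image, Finset.mem_insert, Finset.mem_singleton,
    not_or, not_exists, not_and, Finset.mem_erase, SimpleGraph.mem_neighborFinset] at htE
  obtain ⟨hE1, hE2, htl, htm⟩ := htE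
  set g : V → ℤ := fun u => if u = q then t else w r u with hg
  have hsr : wsum G (reweight w r g) r = wsum G w r - w r q + t := by
    rw [wsum_reweight_self]
    unfold wsum
    rw [← Finset.sum_erase_add _ _ hq, ← Finset.sum_erase_add _ (fun u => w r u) hq]
    rw [Finset.sum_congr rfl fun u hu => show g u = w r u by
      simp [hg, Finset.ne_of_mem_erase hu]]
    simp [hg]
  have hsq : wsum G (reweight w r g) q = wsum G w q - w q r + t := by
    rw [wsum_reweight_of_adj G w g hrq.symm]
    simp [hg]
  have hso : ∀ x, x ≠ r → x ≠ q → wsum G (reweight w r g) x = wsum G w x := by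
    intro x hxr hxq
    by_cases ha : G.Adj x r
    · rw [wsum_reweight_of_adj G w g ha, hsymm x r]
      simp [hg, hxq]
    · exact wsum_reweight_of_not_adj G w g hxr ha
  have hold : ∀ x y, x ≠ r → x ≠ q → reweight w r g x y = w x y := by
    intro x y hxr hxq
    by_cases hyr : y = r
    · subst hyr
      rw [reweight_right w g hxr]
      simp [hg, hxq, hsymm x y]
    · exact reweight_of_ne w g hxr hyr
  have hsymm' := reweight_symm hsymm r g
  have hqC : q ∈ C := hC r hr q hrq
  have hdist : ∀ x ∈ C, ∀ y ∈ C, G.Adj x y → (y = r ∨ y = q → x = r ∨ x = q) →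
      wsum G (reweight w r g) x ≠ wsum G (reweight w r g) y := by
    intro x hx y hy ha hcase
    have h0 := (hw x hx y hy ha).2.2
    by_cases hxr : x = r
    · subst hxr
      by_cases hyq : y = q
      · subst hyq
        rw [hsr, hsq, hsymm y x]
        exact fun e => h0 (by linarith)
      · rw [hsr, hso y ha.ne' hyq]
        exact fun e => hE2 y ⟨hyq, ha⟩ (by linarith)
    · by_cases hxq : x = q
      · subst hxq
        by_cases hyr : y = r
        · subst hyr
          rw [hsr, hsq, hsymm x y]
          exact fun e => h0 (by linarith)
        · rw [hsq, hso y hyr ha.ne']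
          exact fun e => hE1 y ⟨hyr, ha⟩ (by linarith)
      · have hy' : ¬ (y = r ∨ y = q) := fun h => (hcase h).elim hxr hxq
        rw [not_or] at hy'
        rwa [hso x hxr hxq, hso y hy'.1 hy'.2]
  refine ⟨reweight w r g, hsymm', fun x hx y hy ha => ?_, fun x hx h3 => ?_⟩
  · have hb : 1 ≤ reweight w r g x y ∧ reweight w r g x y ≤ 7 := by
      have h0 := hw x hx y hy ha
      have h1 := hw y hy x hx ha.symm
      unfold reweight
      simp only [hg]
      split_ifs
      · omega
      · subst x; omega
      · omega
      · subst y; omega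
      · omega
    refine ⟨hb.1, hb.2, ?_⟩
    by_cases hcase : y = r ∨ y = q → x = r ∨ x = q
    · exact hdist x hx y hy ha hcase
    · exact (hdist y hy x hx ha.symm (by tauto)).symm
  · by_cases hxr : x = r
    · subst hxr
      obtain ⟨z, hz⟩ : ((G.neighborFinset x).erase q).Nonempty := by
        rw [← Finset.card_pos, Finset.card_erase_of_mem hq,
          SimpleGraph.card_neighborFinset_eq_degree]
        omega
      rw [Finset.mem_erase] at hz
      refine ⟨q, hq, z, hz.2, ?_⟩
      rw [reweight_left, reweight_left]
      simp only [hg, hz.1, if_true, if_false]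
      rw [hmono z hz.2 q hq]
      exact htl
    · by_cases hxq : x = q
      · subst hxq
        obtain ⟨z, hz, hzr, hzm⟩ := hm h3
        refine ⟨r, hrmem, z, hz, ?_⟩
        rw [reweight_right w g hxr, reweight_of_ne w g hxr hzr, hzm]
        simpa [hg] using htm
      · obtain ⟨y, hy, z, hz, hyz⟩ := hmix x hx h3 hxr
        exact ⟨y, hy, z, hz, by rwa [hold x y hxr hxq, hold x z hxr hxq]⟩

lemma exists_weighting_component {Δ : ℕ} (hΔ : 3 ≤ Δ) (hd : ∀ x, G.degree x ≤ Δ) {r : V}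
    (hr : 2 ≤ G.degree r) :
    ∃ w : V → V → ℤ, (∀ x y, w x y = w y x) ∧
      (∀ x y, G.Reachable r x → G.Adj x y →
        1 ≤ w x y ∧ w x y ≤ 7 ∧ wsum G w x ≠ wsum G w y) ∧
      ∀ x, G.Reachable r x → G.degree x = Δ →
        ∃ y ∈ G.neighborFinset x, ∃ z ∈ G.neighborFinset x, w x y ≠ w x z := by
  classical
  set C : Finset V := Finset.univ.filter (G.Reachable r) with hCdef
  have hC : ∀ x, x ∈ C ↔ G.Reachable r x := by simp [hCdef]
  have hclosed : ∀ x ∈ C, ∀ y, G.Adj x y → y ∈ C := fun x hx y ha =>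
    (hC y).2 (((hC x).1 hx).trans ha.reachable)
  have hrC : r ∈ C := (hC r).2 (SimpleGraph.Reachable.refl r)
  obtain ⟨w, c, ε, h⟩ := exists_state hC
  obtain ⟨w', hs, hw, hmix⟩ := h.finish (Finset.notMem_erase r C)
    (fun x ha => Finset.mem_erase.2 ⟨ha.ne', hclosed r hrC x ha⟩) hr
  rw [Finset.insert_erase hrC] at hw hmix
  suffices hfin : ∃ w : V → V → ℤ, (∀ x y, w x y = w y x) ∧
      (∀ x ∈ C, ∀ y ∈ C, G.Adj x y → 1 ≤ w x y ∧ w x y ≤ 7 ∧ wsum G w x ≠ wsum G w y) ∧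
      ∀ x ∈ C, G.degree x = Δ →
        ∃ y ∈ G.neighborFinset x, ∃ z ∈ G.neighborFinset x, w x y ≠ w x z by
    obtain ⟨w, h1, h2, h3⟩ := hfin
    exact ⟨w, h1, fun x y hx ha => h2 x ((hC x).2 hx) y (hclosed x ((hC x).2 hx) y ha) ha,
      fun x hx => h3 x ((hC x).2 hx)⟩
  -- A root of degree 3 needs two weights only when Δ = 3; if Δ ≥ 4, a root of degree Δ is already
  -- covered.
  by_cases hrep : Δ = 3 ∧ G.degree r = 3 ∧
      ∀ y ∈ G.neighborFinset r, ∀ z ∈ G.neighborFinset r, w' r y = w' r z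
  · obtain ⟨rfl, hr3, hmono⟩ := hrep
    exact exists_repair hd hclosed hrC hr3 hs hw
      (fun x hx h3 hxr => hmix x hx h3.ge fun e => absurd e hxr) hmono
  · refine ⟨w', hs, hw, fun x hx hxd => ?_⟩
    by_cases hxr : x = r ∧ Δ = 3
    · obtain ⟨rfl, rfl⟩ := hxr
      by_contra! hno
      exact hrep ⟨rfl, hxd, hno⟩
    · exact hmix x hx (by omega) fun e => by
        have : Δ ≠ 3 := fun e' => hxr ⟨e, e'⟩
        omega

end

/-! ### From niceness to a weighting of the whole graph. -/

section
variable {V : Type*} [Fintype V] {G : SimpleGraph V} [DecidableRel G.Adj]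

/-- Otherwise `u` and `v` have no other neighbours and form a component isomorphic to `K₂`. -/
lemma IsNice.two_le_degree (hG : IsNice G) {u v : V} (huv : G.Adj u v) :
    2 ≤ G.degree u ∨ 2 ≤ G.degree v := by
  by_contra! hlt
  have huniq : ∀ {x y z : V}, G.degree x < 2 → G.Adj x y → G.Adj x z → y = z := by
    intro x y z hx hy hz
    rw [← SimpleGraph.card_neighborFinset_eq_degree] at hx
    exact Finset.card_le_one.1 (Nat.lt_succ_iff.1 hx) y (by simpa using hy) z (by simpa using hz)
  have hreach : ∀ x, G.Reachable x u → x = u ∨ x = v := by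
    rintro x ⟨W⟩
    induction W with
    | nil => exact Or.inl rfl
    | cons ha _ ih =>
      rcases ih huv hlt with rfl | rfl
      · exact Or.inr (huniq hlt.1 ha.symm huv)
      · exact Or.inl (huniq hlt.2 ha.symm huv.symm)
  set c := G.connectedComponentMk u with hc
  have hsupp : c.supp = {u, v} := by
    ext x
    rw [SimpleGraph.ConnectedComponent.mem_supp_iff, hc, SimpleGraph.ConnectedComponent.eq]
    constructor
    · exact fun h => hreach x h
    · rintro (rfl | rfl)
      · exact SimpleGraph.Reachable.refl _
      · exact huv.symm.reachable
  have hcard : Nat.card c.supp = 2 := by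
    rw [hsupp, Nat.card_coe_set_eq, Set.ncard_pair huv.ne]
  refine (hG c).false ⟨Finite.equivFinOfCardEq hcard, ?_⟩
  intro a b
  rw [SimpleGraph.top_adj, (Finite.equivFinOfCardEq hcard).injective.ne_iff]
  obtain ⟨a, ha⟩ := a
  obtain ⟨b, hb⟩ := b
  rw [SimpleGraph.ConnectedComponent.toSimpleGraph_adj c ha hb]
  have ha' : a = u ∨ a = v := by
    have : a ∈ c.supp := ha
    simpa [hsupp] using this
  have hb' : b = u ∨ b = v := by
    have : b ∈ c.supp := hb
    simpa [hsupp] using this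
  rw [ne_eq, Subtype.mk.injEq]
  refine ⟨fun hne => ?_, fun h => h.ne⟩
  rcases ha' with rfl | rfl <;> rcases hb' with rfl | rfl
  · exact absurd rfl hne
  · exact huv
  · exact huv.symm
  · exact absurd rfl hne

end

section
variable {V : Type*} [Fintype V] [DecidableEq V] {G : SimpleGraph V} [DecidableRel G.Adj]

lemma exists_weighting_of_three_le {Δ : ℕ} (hΔ : 3 ≤ Δ) (hd : ∀ x, G.degree x ≤ Δ)
    (hG : ∀ u v, G.Adj u v → 2 ≤ G.degree u ∨ 2 ≤ G.degree v) :
    ∃ w : V → V → ℤ, (∀ x y, w x y = w y x) ∧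
      (∀ x y, G.Adj x y → 1 ≤ w x y ∧ w x y ≤ 7 ∧ wsum G w x ≠ wsum G w y) ∧
      ∀ x, G.degree x = Δ →
        ∃ y ∈ G.neighborFinset x, ∃ z ∈ G.neighborFinset x, w x y ≠ w x z := by
  classical
  have hcomp : ∀ K : G.ConnectedComponent, ∃ w : V → V → ℤ, (∀ x y, w x y = w y x) ∧
      (∀ x y, G.connectedComponentMk x = K → G.Adj x y →
        1 ≤ w x y ∧ w x y ≤ 7 ∧ wsum G w x ≠ wsum G w y) ∧
      ∀ x, G.connectedComponentMk x = K → G.degree x = Δ →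
        ∃ y ∈ G.neighborFinset x, ∃ z ∈ G.neighborFinset x, w x y ≠ w x z := by
    intro K
    by_cases hr : ∃ r, G.connectedComponentMk r = K ∧ 2 ≤ G.degree r
    · obtain ⟨r, rfl, hr⟩ := hr
      obtain ⟨w, h1, h2, h3⟩ := exists_weighting_component hΔ hd hr
      exact ⟨w, h1, fun x y hx => h2 x y (SimpleGraph.ConnectedComponent.eq.1 hx).symm,
        fun x hx => h3 x (SimpleGraph.ConnectedComponent.eq.1 hx).symm⟩
    · push Not at hr
      -- Such a component has no edges, so any weights do.
      refine ⟨fun _ _ => 0, fun _ _ => rfl, fun x y hx ha => ?_, fun x hx hxd => ?_⟩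
      · have hy : G.connectedComponentMk y = K :=
          (SimpleGraph.ConnectedComponent.sound ha.symm.reachable).trans hx
        have h1 := hr x hx
        have h2 := hr y hy
        have h3 := hG x y ha
        omega
      · have := hr x hx
        omega
  choose W hs hw hmix using hcomp
  set w : V → V → ℤ := fun x y =>
    if G.connectedComponentMk x = G.connectedComponentMk y then
      W (G.connectedComponentMk x) x y else 0 with hwdef
  have hadj : ∀ x y, G.Adj x y → w x y = W (G.connectedComponentMk x) x y := by
    intro x y ha
    exact if_pos (SimpleGraph.ConnectedComponent.sound ha.reachable)
  have hsum : ∀ x, wsum G w x = wsum G (W (G.connectedComponentMk x)) x := fun x =>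
    Finset.sum_congr rfl fun y hy => hadj x y (by simpa using hy)
  refine ⟨w, fun x y => ?_, fun x y ha => ?_, fun x hx => ?_⟩
  · by_cases h : G.connectedComponentMk x = G.connectedComponentMk y
    · simp only [hwdef, h, if_true, hs _ x y]
    · simp only [hwdef, h, Ne.symm h, if_false]
  · have hxy := SimpleGraph.ConnectedComponent.sound ha.reachable
    rw [hadj x y ha, hsum, hsum, ← hxy]
    exact hw _ x y rfl ha
  · obtain ⟨y, hy, z, hz, hyz⟩ := hmix _ x rfl hx
    refine ⟨y, hy, z, hz, ?_⟩
    rwa [hadj x y (by simpa using hy), hadj x z (by simpa using hz)]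

end

/-! ### Maximum degree at most 2. -/

/-- Greedy colouring with the colours `1, …, 7`. -/
lemma exists_greedy_coloring {α : Type*} [DecidableEq α] {R : α → α → Prop} [DecidableRel R]
    (hsymm : ∀ a b, R a b → R b a) (E : Finset α)
    (hE : ∀ a ∈ E, (E.filter fun b => b ≠ a ∧ R a b).card ≤ 6) :
    ∃ f : α → ℤ, (∀ a ∈ E, 1 ≤ f a ∧ f a ≤ 7) ∧
      ∀ a ∈ E, ∀ b ∈ E, a ≠ b → R a b → f a ≠ f b := by
  suffices h : ∀ s ⊆ E, ∃ f : α → ℤ, (∀ a ∈ s, 1 ≤ f a ∧ f a ≤ 7) ∧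
      ∀ a ∈ s, ∀ b ∈ s, a ≠ b → R a b → f a ≠ f b from h E subset_rfl
  intro s
  induction s using Finset.induction_on with
  | empty => exact fun _ => ⟨0, by simp, by simp⟩
  | insert a s ha ih =>
    intro hs
    obtain ⟨f, hf, hR⟩ := ih ((Finset.subset_insert a s).trans hs)
    obtain ⟨t, ht, htN⟩ := Finset.exists_mem_notMem_of_card_lt_card
      (s := (E.filter fun b => b ≠ a ∧ R a b).image f) (t := Finset.Icc (1 : ℤ) 7)
      ((Finset.card_image_le.trans (hE a (hs (Finset.mem_insert_self a s)))).trans_lt (by simp))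
    have htne : ∀ b ∈ s, R a b → t ≠ f b := fun b hb hab e => htN <| Finset.mem_image.2
      ⟨b, Finset.mem_filter.2 ⟨hs (Finset.mem_insert_of_mem hb), fun e => ha (e ▸ hb), hab⟩, e.symm⟩
    have hne : ∀ b ∈ s, b ≠ a := fun b hb e => ha (e ▸ hb)
    refine ⟨Function.update f a t, fun b hb => ?_, fun b hb d hd hbd hr => ?_⟩
    · rcases Finset.mem_insert.1 hb with rfl | hb
      · simpa using Finset.mem_Icc.1 ht
      · rw [Function.update_of_ne (hne b hb)]
        exact hf b hb
    · rcases Finset.mem_insert.1 hb with e | hb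
      · have hd := (Finset.mem_insert.1 hd).resolve_left fun e' => hbd (e.trans e'.symm)
        rw [e, Function.update_self, Function.update_of_ne (hne d hd)]
        exact htne d hd (e ▸ hr)
      · rw [Function.update_of_ne (hne b hb)]
        rcases Finset.mem_insert.1 hd with e | hd
        · rw [e, Function.update_self]
          exact (htne b hb (hsymm _ _ (e ▸ hr))).symm
        · rw [Function.update_of_ne (hne d hd)]
          exact hR b hb d hd hbd hr

section
variable {V : Type*} [Fintype V] [DecidableEq V] {G : SimpleGraph V} [DecidableRel G.Adj]

/-- Edges that share an end or are joined by an edge get different weights. Adjacent sums share the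
weight of the common edge, and what remains differs: two conflicting edges, or one positive weight
against nothing. -/
lemma exists_weighting_of_degree_le_two (hd : ∀ x, G.degree x ≤ 2)
    (hG : ∀ u v, G.Adj u v → 2 ≤ G.degree u ∨ 2 ≤ G.degree v) :
    ∃ w : V → V → ℤ, (∀ x y, w x y = w y x) ∧
      (∀ x y, G.Adj x y → 1 ≤ w x y ∧ w x y ≤ 7 ∧ wsum G w x ≠ wsum G w y) ∧
      ∀ x, G.degree x = 2 →
        ∃ y ∈ G.neighborFinset x, ∃ z ∈ G.neighborFinset x, w x y ≠ w x z := by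
  classical
  obtain ⟨f, hf, hR⟩ := exists_greedy_coloring
    (R := fun e f : Sym2 V => ∃ x ∈ e, ∃ y ∈ f, x = y ∨ G.Adj x y)
    (fun e f ⟨x, hx, y, hy, h⟩ => ⟨y, hy, x, hx, h.imp Eq.symm SimpleGraph.Adj.symm⟩)
    G.edgeFinset (by
      intro e he
      induction e with | _ u v
      rw [SimpleGraph.mem_edgeFinset, SimpleGraph.mem_edgeSet] at he
      have inc : ∀ x, (G.incidenceFinset x).card ≤ 2 := fun x => by
        rw [SimpleGraph.card_incidenceFinset_eq_degree]; exact hd x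
      have inc1 : ∀ x ∈ s(u, v), ((G.incidenceFinset x).erase s(u, v)).card ≤ 1 := fun x hx => by
        rw [Finset.card_erase_of_mem (by
          rw [SimpleGraph.mem_incidenceFinset]; exact ⟨he, hx⟩)]
        have := inc x
        omega
      have nb : ∀ x y, G.Adj x y → (((G.neighborFinset x).erase y).biUnion
          fun z => G.incidenceFinset z).card ≤ 2 := fun x y ha => by
        refine (Finset.card_biUnion_le_card_mul _ _ 2 fun z _ => inc z).trans ?_
        rw [Finset.card_erase_of_mem (by simpa using ha),
          SimpleGraph.card_neighborFinset_eq_degree]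
        have := hd x
        omega
      -- An edge has at most six conflicts: one further edge at each end, and two at the other
      -- neighbour of each end.
      have hsub : (G.edgeFinset.filter fun f => f ≠ s(u, v) ∧
          ∃ x ∈ s(u, v), ∃ y ∈ f, x = y ∨ G.Adj x y) ⊆
          ((G.incidenceFinset u).erase s(u, v) ∪ (G.incidenceFinset v).erase s(u, v)) ∪
          ((((G.neighborFinset u).erase v).biUnion fun z => G.incidenceFinset z) ∪
            (((G.neighborFinset v).erase u).biUnion fun z => G.incidenceFinset z)) := by
        intro f hf
        rw [Finset.mem_filter, SimpleGraph.mem_edgeFinset] at hf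
        obtain ⟨hfE, hfe, x, hx, y, hy, hxy⟩ := hf
        simp only [Finset.mem_union, Finset.mem_erase, Finset.mem_biUnion,
          SimpleGraph.mem_incidenceFinset, SimpleGraph.mem_neighborFinset]
        by_cases hyu : y = u
        · exact Or.inl (Or.inl ⟨hfe, hfE, hyu ▸ hy⟩)
        by_cases hyv : y = v
        · exact Or.inl (Or.inr ⟨hfe, hfE, hyv ▸ hy⟩)
        right
        rcases Sym2.mem_iff.1 hx with rfl | rfl
        · exact Or.inl ⟨y, ⟨hyv, hxy.resolve_left (Ne.symm hyu)⟩, hfE, hy⟩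
        · exact Or.inr ⟨y, ⟨hyu, hxy.resolve_left (Ne.symm hyv)⟩, hfE, hy⟩
      have h1 := Finset.card_le_card hsub
      have h2 := inc1 u (by simp)
      have h3 := inc1 v (by simp)
      have h4 := nb u v he
      have h5 := nb v u he.symm
      have h6 := Finset.card_union_le ((G.incidenceFinset u).erase s(u, v))
        ((G.incidenceFinset v).erase s(u, v))
      have h7 := Finset.card_union_le
        (((G.neighborFinset u).erase v).biUnion fun z => G.incidenceFinset z)
        (((G.neighborFinset v).erase u).biUnion fun z => G.incidenceFinset z)
      exact h1.trans ((Finset.card_union_le _ _).trans (by omega)))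
  have hmem : ∀ {x y}, G.Adj x y → s(x, y) ∈ G.edgeFinset := fun ha => by
    rwa [SimpleGraph.mem_edgeFinset, SimpleGraph.mem_edgeSet]
  refine ⟨fun x y => f s(x, y), fun x y => congrArg f Sym2.eq_swap, fun x y ha => ?_, fun x hx => ?_⟩
  · refine ⟨(hf _ (hmem ha)).1, (hf _ (hmem ha)).2, ?_⟩
    have sums : ∀ x y, G.Adj x y → (G.degree x < 2 ∧ wsum G (fun x y => f s(x, y)) x = f s(x, y)) ∨
        ∃ z, z ≠ y ∧ G.Adj x z ∧ wsum G (fun x y => f s(x, y)) x = f s(x, z) + f s(x, y) := by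
      intro x y ha
      have hy : y ∈ G.neighborFinset x := by simpa using ha
      have hcard : ((G.neighborFinset x).erase y).card = G.degree x - 1 := by
        rw [Finset.card_erase_of_mem hy, SimpleGraph.card_neighborFinset_eq_degree]
      have hle := hd x
      unfold wsum
      rw [← Finset.sum_erase_add _ _ hy]
      rcases Finset.eq_empty_or_nonempty ((G.neighborFinset x).erase y) with h | ⟨z, hz⟩
      · left
        rw [h] at hcard ⊢
        simp only [Finset.card_empty] at hcard
        exact ⟨by omega, by simp⟩
      · right
        have hone : (G.neighborFinset x).erase y = {z} :=
          Finset.eq_singleton_iff_unique_mem.2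
            ⟨hz, fun z' hz' => Finset.card_le_one.1 (by omega) z' hz' z hz⟩
        rw [Finset.mem_erase, SimpleGraph.mem_neighborFinset] at hz
        exact ⟨z, hz.1, hz.2, by rw [hone, Finset.sum_singleton]⟩
    have hsw : f s(y, x) = f s(x, y) := by rw [Sym2.eq_swap]
    rcases sums x y ha with ⟨h1, h2⟩ | ⟨a, ha1, ha2, ha3⟩ <;>
      rcases sums y x ha.symm with ⟨h3, h4⟩ | ⟨b, hb1, hb2, hb3⟩
    · have := hG x y ha
      omega
    · have := hf _ (hmem hb2)
      omega
    · have := hf _ (hmem ha2)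
      omega
    · have := hR s(x, a) (hmem ha2) s(y, b) (hmem hb2) (fun e => by
        rcases Sym2.eq_iff.1 e with ⟨h, -⟩ | ⟨h, -⟩
        · exact ha.ne h
        · exact hb1 h.symm) ⟨x, by simp, y, by simp, Or.inr ha⟩
      omega
  · obtain ⟨y, z, hyz, hN⟩ := Finset.card_eq_two.1
      ((SimpleGraph.card_neighborFinset_eq_degree G x).trans hx)
    have hy : y ∈ G.neighborFinset x := by simp [hN]
    have hz : z ∈ G.neighborFinset x := by simp [hN]
    refine ⟨y, hy, z, hz, hR _ (hmem (by simpa using hy)) _ (hmem (by simpa using hz)) ?_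
      ⟨x, by simp, x, by simp, Or.inl rfl⟩⟩
    intro e
    exact hyz (Sym2.congr_right.1 e)

end

/-! ### Translation to `relaxedIndex` and conclusion. -/

section
variable {V : Type*} [Fintype V] {G : SimpleGraph V} [DecidableRel G.Adj]

/-- A monochromatic set of degree Δ at a vertex would contain all its edges, contradicting the two
weights seen there. -/
lemma relaxedIndex_le_seven {w : V → V → ℤ} (hs : ∀ x y, w x y = w y x)
    (hw : ∀ x y, G.Adj x y → 1 ≤ w x y ∧ w x y ≤ 7 ∧ wsum G w x ≠ wsum G w y)
    (hmix : ∀ x, 0 < G.degree x → G.degree x = G.maxDegree →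
      ∃ y ∈ G.neighborFinset x, ∃ z ∈ G.neighborFinset x, w x y ≠ w x z) :
    relaxedIndex G (G.maxDegree - 1) ≤ 7 := by
  set ω : G.edgeSet → ℕ := fun e => (Sym2.lift ⟨w, hs⟩ e.1).toNat with hω
  have hval : ∀ x y (h : G.Adj x y), (ω ⟨s(x, y), h⟩ : ℤ) = w x y := by
    intro x y h
    have := hw x y h
    simp only [hω, Sym2.lift_mk]
    omega
  have hsum : ∀ x, (vertexSum G ω x : ℤ) = wsum G w x := by
    intro x
    unfold vertexSum wsum
    rw [Nat.cast_sum]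
    exact (Finset.sum_congr rfl fun y _ => hval x y.1 y.2).trans
      (Finset.sum_subtype (G.neighborFinset x) (fun y => by simp) (w x)).symm
  refine sInf_le ⟨7, by norm_num, by norm_num, ω, ?_, ?_, ?_⟩
  · rintro ⟨e, he⟩
    induction e with | _ x y
    have h1 := hval x y he
    have h2 := hw x y he
    exact ⟨by omega, by omega⟩
  · intro x y ha e
    apply (hw x y ha).2.2
    rw [← hsum, ← hsum, e]
  · intro F hF
    -- Generalising the subgraph frees the argument from the particular decidability instance in
    -- `IsRelaxed`.
    suffices h : ∀ (H : SimpleGraph V) (_ : DecidableRel H.Adj),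
        H = SimpleGraph.fromEdgeSet (Subtype.val '' F : Set (Sym2 V)) →
        H.maxDegree ≤ G.maxDegree - 1 from h _ _ rfl
    intro H _ hH
    apply SimpleGraph.maxDegree_le_of_forall_degree_le
    intro x
    have hHadj : ∀ y, H.Adj x y → ∃ h : G.Adj x y, (⟨s(x, y), h⟩ : G.edgeSet) ∈ F := by
      intro y hy
      rw [hH, SimpleGraph.fromEdgeSet_adj] at hy
      obtain ⟨⟨⟨e, he⟩, heF, rfl⟩, -⟩ := hy
      exact ⟨he, heF⟩
    have hsub : H.neighborFinset x ⊆ G.neighborFinset x := by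
      intro y hy
      rw [SimpleGraph.mem_neighborFinset] at hy ⊢
      exact (hHadj y hy).1
    have hle := Finset.card_le_card hsub
    rw [SimpleGraph.card_neighborFinset_eq_degree, SimpleGraph.card_neighborFinset_eq_degree] at hle
    have hmax := G.degree_le_maxDegree x
    by_contra! hlt
    obtain ⟨y, hy, z, hz, hyz⟩ := hmix x (by omega) (by omega)
    have heq := Finset.eq_of_subset_of_card_le hsub (by
      rw [SimpleGraph.card_neighborFinset_eq_degree, SimpleGraph.card_neighborFinset_eq_degree]
      omega)
    rw [← heq, SimpleGraph.mem_neighborFinset] at hy hz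
    obtain ⟨h1, h2⟩ := hHadj y hy
    obtain ⟨h3, h4⟩ := hHadj z hz
    apply hyz
    rw [← hval x y h1, ← hval x z h3, hF _ h2 _ h4]

end

end NeighbourSum

theorem mainTheorem1 {V : Type*} [Fintype V] (G : SimpleGraph V) [DecidableRel G.Adj]
    (hG : NeighbourSum.IsNice G) :
    NeighbourSum.relaxedIndex G (G.maxDegree - 1) ≤ 7 := by
  classical
  have hnice : ∀ u v, G.Adj u v → 2 ≤ G.degree u ∨ 2 ≤ G.degree v :=
    fun u v h => hG.two_le_degree h
  rcases le_or_gt 3 G.maxDegree with h3 | h3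
  · obtain ⟨w, h1, h2, h3⟩ :=
      NeighbourSum.exists_weighting_of_three_le h3 G.degree_le_maxDegree hnice
    exact NeighbourSum.relaxedIndex_le_seven h1 h2 fun x _ => h3 x
  · have hd : ∀ x, G.degree x ≤ 2 := fun x => (G.degree_le_maxDegree x).trans (by omega)
    obtain ⟨w, h1, h2, h3⟩ := NeighbourSum.exists_weighting_of_degree_le_two hd hnice
    -- If `x` has an edge, niceness gives one of its ends degree 2, so the maximum degree is exactly
    -- 2.
    refine NeighbourSum.relaxedIndex_le_seven h1 h2 fun x hx hxm => h3 x ?_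
    rw [← SimpleGraph.card_neighborFinset_eq_degree, Finset.card_pos] at hx
    obtain ⟨y, hy⟩ := hx
    have := hnice x y (by simpa using hy)
    have := G.degree_le_maxDegree y
    have := hd x
    omega
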